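/- Let $\Gamma$ be a countably infinite discrete group. A $\Gamma$-flow is a nonempty compact Hausdorff space $X$ equipped with a continuous action of $\Gamma$; it is free if every point of $X$ has trivial stabilizer, and, for a subset $S \subseteq \Gamma$, it is $S$-minimal if the partial orbit $S \cdot x = \{\gamma \cdot x : \gamma \in S\}$ is dense in $X$ for every $x \in X$. A group is locally finite if all of its finitely generated subgroups are finite. Then: (1) There exists a free $\Gamma$-flow that is $\Delta$-minimal for every subgroup $\Delta \le \Gamma$ that is not locally finite. (2) If $\Gamma$ has at most countably many infinite locally finite subgroups, then there exists a free $\Gamma$-flow that is $\Delta$-minimal for every infinite subgroup $\Delta \le \Gamma$. -/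

import Mathlib

universe u v

/-- `X` is a `Γ`-flow for the discrete group `Γ`: a nonempty compact Hausdorff space on which `Γ`
acts continuously. As `Γ` is discrete, continuity of the action means that each `γ : Γ` acts by a
continuous map. -/
structure IsFlow (Γ : Type u) (X : Type v) [Group Γ] [TopologicalSpace X] [MulAction Γ X] :
    Prop where
  nonempty : Nonempty X
  compactSpace : CompactSpace X
  t2Space : T2Space X
  continuousConstSMul : ContinuousConstSMul Γ X

/-- The action of `Γ` on `X` is free: the stabilizer of every point is trivial. -/
def IsFreeAction (Γ : Type u) (X : Type v) [Group Γ] [MulAction Γ X] : Prop :=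
  ∀ x : X, MulAction.stabilizer Γ x = ⊥

/-- `X` is `S`-minimal for a subset `S` of `Γ`: for every point `x` of `X`, the partial orbit
`S • x = {γ • x | γ ∈ S}` is dense in `X`. -/
def IsMinimalFor {Γ : Type u} [Group Γ] (S : Set Γ) (X : Type v) [TopologicalSpace X]
    [MulAction Γ X] : Prop :=
  ∀ x : X, Dense ((fun γ : Γ => γ • x) '' S)

/-- The subgroup `Δ` is locally finite: all its finitely generated subgroups are finite. -/
def IsLocallyFiniteSubgroup {Γ : Type u} [Group Γ] (Δ : Subgroup Γ) : Prop :=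
  ∀ K : Subgroup Γ, K ≤ Δ → K.FG → (K : Set Γ).Finite

/-! A subgroup that is not locally finite contains an infinite finitely generated one, `Γ` has only
countably many of these, and minimality passes to larger subgroups. So both parts follow from one
free flow that is minimal for countably many prescribed infinite subgroups
(`exists_flow_of_sequence`).

The flow is the orbit closure, under the right shift, of one configuration `x : ℕ → Γ → Fin 3`. Left
multiplication commutes with the shift, so requiring layer `i` to be a proper colouring for left
multiplication by `c i` is a closed invariant condition, and it gives freeness. Minimality follows
if every window of `x` recurs, from every point, along a finite subset of each conjugate of each
prescribed subgroup.

Such an `x` is a limit of finite patterns (`exists_levels`). Inside a new finite support, patches of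
all earlier levels are placed from the highest level down. Near a point, either a higher patch
already contains the wanted pattern, or many positions avoid all higher patches (`card_admissible`).
A counting argument for independent transversals selects compatible positions
(`exists_separated_syndetic`). This needs supports that do not cut too many translates of earlier
margins; `HasShapes.exists_returns` keeps such supports available while choosing return times in the
prescribed subgroup, and uses only that it is infinite. -/

/-! ### Independent transversals by counting -/

section Transversal

open scoped Classical in
/-- The partial transversals of the family `Q` over `S` (equal to `c` outside `S`) that are
independent for the relation `R`. -/
noncomputable def partialTransversals {ι V : Type*} [Fintype ι] (Q : ι → Finset V)
    (R : V → V → Prop) (c : ι → V) (S : Finset ι) : Finset (ι → V) :=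
  (Fintype.piFinset Q).filter fun f =>
    (∀ i, i ∉ S → f i = c i) ∧ ∀ i ∈ S, ∀ j ∈ S, i ≠ j → ¬ R (f i) (f j)

/-- Each further part multiplies the number of independent partial transversals by at
least `2 * N`. -/
theorem two_mul_card_partialTransversals_le {ι V : Type*} [Fintype ι] [DecidableEq ι]
    (Q : ι → Finset V) (R : V → V → Prop) (hR : ∀ x y, R x y → R y x) (c : ι → V)
    (hc : ∀ i, c i ∈ Q i) (N : ℕ)
    (hQ : ∀ i, 4 * N ≤ (Q i).card)
    (hdisj : ∀ i j x, x ∈ Q i → x ∈ Q j → i = j)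
    (hdeg : ∀ x, ∃ B : Finset V, B.card ≤ N ∧ ∀ y, R x y → y ∈ B) :
    ∀ (n : ℕ) (S : Finset ι), S.card = n → ∀ w, w ∉ S →
      2 * N * (partialTransversals Q R c S).card ≤
        (partialTransversals Q R c (insert w S)).card := by
  classical
  intro n
  induction n using Nat.strong_induction_on with
  | _ n ih =>
  intro S hS w hw
  choose B hBcard hB using hdeg
  set T := partialTransversals Q R c with hT
  have memT : ∀ (S : Finset ι) f, f ∈ T S ↔ (∀ i, f i ∈ Q i) ∧ (∀ i, i ∉ S → f i = c i) ∧
      ∀ i ∈ S, ∀ j ∈ S, i ≠ j → ¬ R (f i) (f j) := by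
    intro S f
    simp [hT, partialTransversals, Fintype.mem_piFinset]
  -- the conflicting pairs
  let P : V → Finset (ι × V) := fun x =>
    ((S ×ˢ B x)).filter fun p => p.2 ∈ Q p.1
  have hP : ∀ x, (P x).card ≤ N := by
    intro x
    refine le_trans ?_ (hBcard x)
    refine Finset.card_le_card_of_injOn Prod.snd ?_ ?_
    · intro p hp
      simp only [P, Finset.coe_filter, Finset.mem_product, Set.mem_ofPred_eq] at hp
      exact hp.1.2
    · rintro ⟨i, y⟩ hp ⟨j, z⟩ hq h
      simp only [P, Finset.coe_filter, Finset.mem_product, Set.mem_ofPred_eq] at hp hq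
      simp only at h
      subst h
      rw [hdisj i j y hp.2 hq.2]
  -- Resetting coordinate `j` to `c j` is injective on this fibre and lands in the transversals over
  -- `S.erase j`, where the induction hypothesis applies.
  have hfib : ∀ j ∈ S, ∀ y, 2 * N * ((T S).filter fun f => f j = y).card ≤ (T S).card := by
    intro j hj y
    have h1 : ((T S).filter fun f => f j = y).card ≤ (T (S.erase j)).card := by
      refine Finset.card_le_card_of_injOn (fun f => Function.update f j (c j)) ?_ ?_
      · intro f hf
        have hf := (Finset.mem_filter.1 hf).1
        rw [memT] at hf
        refine (memT _ _).2 ⟨?_, ?_, ?_⟩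
        · intro i
          by_cases h : i = j
          · subst h; simpa using hc i
          · simpa [h] using hf.1 i
        · intro i hi
          by_cases h : i = j
          · subst h; simp
          · simp only [Function.update_of_ne h]
            exact hf.2.1 i fun hi' => hi (Finset.mem_erase.2 ⟨h, hi'⟩)
        · intro i hi k hk hik
          have hi := Finset.mem_erase.1 hi
          have hk := Finset.mem_erase.1 hk
          simp only [Function.update_of_ne hi.1, Function.update_of_ne hk.1]
          exact hf.2.2 i hi.2 k hk.2 hik
      · intro f hf g hg h
        have hf := (Finset.mem_filter.1 hf).2
        have hg := (Finset.mem_filter.1 hg).2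
        funext i
        by_cases hi : i = j
        · subst hi; rw [hf, hg]
        · have := congrFun h i
          simpa [hi] using this
    have hcard : (S.erase j).card < n := by
      rw [← hS]; exact Finset.card_erase_lt_of_mem hj
    have h2 := ih _ hcard (S.erase j) rfl j (Finset.notMem_erase j S)
    rw [Finset.insert_erase hj] at h2
    exact le_trans (Nat.mul_le_mul_left _ h1) h2
  -- the extensions of elements of `T S`
  let bad : Finset ((ι → V) × V) :=
    (Q w).biUnion fun x => (P x).biUnion fun p =>
      ((T S).filter fun f => f p.1 = p.2).image fun f => (f, x)
  -- Each `x` has at most `N` conflicting pairs, and each pair excludes at most a `1 / (2 * N)`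
  -- fraction of `T S`. Hence at most half of all extensions are bad.
  have hbad : 2 * bad.card ≤ (Q w).card * (T S).card := by
    rcases Nat.eq_zero_or_pos N with hN | hN
    · have hPe : ∀ x, P x = ∅ := fun x => Finset.card_eq_zero.1 (by have := hP x; omega)
      have : bad = ∅ := by ext; simp [bad, hPe]
      simp [this]
    · have h1 : N * (2 * bad.card) ≤ N * ((Q w).card * (T S).card) := by
        have hb : bad.card ≤ ∑ x ∈ Q w, ∑ p ∈ P x, ((T S).filter fun f => f p.1 = p.2).card := by
          refine Finset.card_biUnion_le.trans (Finset.sum_le_sum fun x _ => ?_)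
          refine Finset.card_biUnion_le.trans (Finset.sum_le_sum fun p _ => ?_)
          exact Finset.card_image_le
        calc N * (2 * bad.card) = 2 * N * bad.card := by ring
          _ ≤ 2 * N * ∑ x ∈ Q w, ∑ p ∈ P x, ((T S).filter fun f => f p.1 = p.2).card :=
              Nat.mul_le_mul_left _ hb
          _ = ∑ x ∈ Q w, ∑ p ∈ P x, 2 * N * ((T S).filter fun f => f p.1 = p.2).card := by
              rw [Finset.mul_sum]; simp_rw [Finset.mul_sum]
          _ ≤ ∑ x ∈ Q w, ∑ p ∈ P x, (T S).card := by
              refine Finset.sum_le_sum fun x _ => Finset.sum_le_sum fun p hp => ?_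
              have hp := (Finset.mem_filter.1 hp).1
              exact hfib _ (Finset.mem_product.1 hp).1 _
          _ = ∑ x ∈ Q w, (P x).card * (T S).card := by simp
          _ ≤ ∑ x ∈ Q w, N * (T S).card :=
              Finset.sum_le_sum fun x _ => Nat.mul_le_mul_right _ (hP x)
          _ = N * ((Q w).card * (T S).card) := by simp; ring
      exact Nat.le_of_mul_le_mul_left h1 hN
  have hgood : ((T S ×ˢ Q w) \ bad).card ≤ (T (insert w S)).card := by
    refine Finset.card_le_card_of_injOn (fun q => Function.update q.1 w q.2) ?_ ?_
    · rintro ⟨f, x⟩ hq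
      have hq := Finset.mem_sdiff.1 (Finset.mem_coe.1 hq)
      obtain ⟨hf, hx⟩ := Finset.mem_product.1 hq.1
      simp only at hf hx
      have hf' := (memT S f).1 hf
      have key : ∀ j ∈ S, ¬ R x (f j) := by
        intro j hj hRx
        apply hq.2
        simp only [bad, Finset.mem_biUnion, Finset.mem_image, Finset.mem_filter]
        refine ⟨x, hx, (j, f j), ?_, f, ⟨hf, rfl⟩, rfl⟩
        simp only [P, Finset.mem_filter, Finset.mem_product]
        exact ⟨⟨hj, hB x _ hRx⟩, hf'.1 j⟩
      refine (memT _ _).2 ⟨?_, ?_, ?_⟩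
      · intro i
        by_cases h : i = w
        · subst h; simpa using hx
        · simpa [h] using hf'.1 i
      · intro i hi
        simp only [Finset.mem_insert, not_or] at hi
        simpa [hi.1] using hf'.2.1 i hi.2
      · intro i hi k hk hik
        rcases Finset.mem_insert.1 hi with rfl | hi'
        · rcases Finset.mem_insert.1 hk with rfl | hk'
          · exact absurd rfl hik
          · simpa [Ne.symm hik] using key k hk'
        · rcases Finset.mem_insert.1 hk with rfl | hk'
          · simpa [hik] using fun h => key i hi' (hR _ _ h)
          · have h1 : i ≠ w := fun h => hw (h ▸ hi')
            have h2 : k ≠ w := fun h => hw (h ▸ hk')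
            simpa [h1, h2] using hf'.2.2 i hi' k hk' hik
    · rintro ⟨f, x⟩ hq ⟨g, y⟩ hq' h
      have hf := (Finset.mem_product.1 (Finset.mem_sdiff.1 (Finset.mem_coe.1 hq)).1).1
      have hg := (Finset.mem_product.1 (Finset.mem_sdiff.1 (Finset.mem_coe.1 hq')).1).1
      have hf' := (memT S f).1 hf
      have hg' := (memT S g).1 hg
      have hxy : x = y := by simpa using congrFun h w
      have hfg : f = g := by
        funext i
        by_cases hi : i = w
        · subst hi; rw [hf'.2.1 i hw, hg'.2.1 i hw]
        · simpa [hi] using congrFun h i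
      rw [hxy, hfg]
  have h1 : (T S ×ˢ Q w).card ≤ ((T S ×ˢ Q w) \ bad).card + bad.card := by
    have := Finset.le_card_sdiff bad (T S ×ˢ Q w)
    omega
  rw [Finset.card_product] at h1
  have h2 : 4 * N * (T S).card ≤ (Q w).card * (T S).card := Nat.mul_le_mul_right _ (hQ w)
  have h3 : (T S).card * (Q w).card = (Q w).card * (T S).card := mul_comm _ _
  have h4 : 4 * N * (T S).card = 2 * (2 * N * (T S).card) := by ring
  omega

/-- A family of disjoint finite sets of size at least `4 * N` has an independent transversal for
any symmetric relation of degree at most `N`. -/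
theorem exists_independent_transversal {ι V : Type*} [Fintype ι]
    (Q : ι → Finset V) (R : V → V → Prop) (hR : ∀ x y, R x y → R y x) (N : ℕ) (hN : 0 < N)
    (hQ : ∀ i, 4 * N ≤ (Q i).card)
    (hdisj : ∀ i j x, x ∈ Q i → x ∈ Q j → i = j)
    (hdeg : ∀ x, ∃ B : Finset V, B.card ≤ N ∧ ∀ y, R x y → y ∈ B) :
    ∃ f : ι → V, (∀ i, f i ∈ Q i) ∧ ∀ i j, i ≠ j → ¬ R (f i) (f j) := by
  classical
  have hne : ∀ i, ∃ x, x ∈ Q i := fun i =>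
    Finset.card_pos.1 (by have := hQ i; omega)
  choose c hc using hne
  have hpos : ∀ S : Finset ι, 0 < (partialTransversals Q R c S).card := by
    intro S
    induction S using Finset.induction_on with
    | empty =>
      refine Finset.card_pos.2 ⟨c, ?_⟩
      simp [partialTransversals, Fintype.mem_piFinset, hc]
    | insert w S hw ih =>
      have := two_mul_card_partialTransversals_le Q R hR c hc N hQ hdisj hdeg _ S rfl w hw
      refine lt_of_lt_of_le ?_ this
      positivity
  obtain ⟨f, hf⟩ := Finset.card_pos.1 (hpos Finset.univ)
  simp only [partialTransversals, Finset.mem_filter, Fintype.mem_piFinset] at hf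
  exact ⟨f, hf.1, fun i j h => hf.2.2 i (Finset.mem_univ i) j (Finset.mem_univ j) h⟩

end Transversal

/-! ### Separated and syndetic sets of positions -/

section Selection

variable {Γ : Type*} [Group Γ]

theorem exists_maximal_disjoint_translates (D U : Finset Γ) (hD : D.Nonempty) :
    ∃ W ⊆ U, (∀ w ∈ W, ∀ w' ∈ W, w ≠ w' → ∀ d ∈ D, ∀ d' ∈ D, d * w ≠ d' * w') ∧
      ∀ u ∈ U, ∃ w ∈ W, ∃ d ∈ D, ∃ d' ∈ D, d * u = d' * w := by
  classical
  induction U using Finset.induction_on with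
  | empty => exact ⟨∅, by simp, by simp, by simp⟩
  | insert a U ha ih =>
    obtain ⟨W, hWU, hW, hmax⟩ := ih
    by_cases h : ∃ w ∈ W, ∃ d ∈ D, ∃ d' ∈ D, d * a = d' * w
    · refine ⟨W, hWU.trans (Finset.subset_insert _ _), hW, ?_⟩
      intro u hu
      rcases Finset.mem_insert.1 hu with rfl | hu
      · exact h
      · exact hmax u hu
    · push Not at h
      refine ⟨insert a W, Finset.insert_subset_insert _ hWU, ?_, ?_⟩
      · intro w hw w' hw' hne d hd d' hd'
        rcases Finset.mem_insert.1 hw with rfl | h₁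
        · rcases Finset.mem_insert.1 hw' with rfl | h₂
          · exact absurd rfl hne
          · exact h w' h₂ d hd d' hd'
        · rcases Finset.mem_insert.1 hw' with rfl | h₂
          · exact fun e => h w h₁ d' hd' d hd e.symm
          · exact hW w h₁ w' h₂ hne d hd d' hd'
      · intro u hu
        rcases Finset.mem_insert.1 hu with rfl | hu
        · obtain ⟨d, hd⟩ := hD
          exact ⟨u, Finset.mem_insert_self _ _, d, hd, d, hd, rfl⟩
        · obtain ⟨w, hw, h⟩ := hmax u hu
          exact ⟨w, Finset.mem_insert_of_mem hw, h⟩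

open scoped Pointwise Classical in
/-- If every `u ∈ U` comes with at least `4 * |G| ^ 2` admissible elements of `D`, there is a set
`V` of admissible positions with disjoint translates of `G` which is syndetic in `U`. -/
theorem exists_separated_syndetic (G D U : Finset Γ) (hG : G.Nonempty) (hD : D.Nonempty)
    (Q : Γ → Finset Γ) (hQD : ∀ u, Q u ⊆ D) (hQ : ∀ u ∈ U, 4 * G.card ^ 2 ≤ (Q u).card) :
    ∃ V : Finset Γ, (∀ v ∈ V, ∃ u ∈ U, ∃ d ∈ Q u, v = d * u) ∧
      (∀ v ∈ V, ∀ v' ∈ V, v ≠ v' → ∀ g ∈ G, ∀ g' ∈ G, g * v ≠ g' * v') ∧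
      ∀ u ∈ U, ∃ d ∈ D * D⁻¹ * D, d * u ∈ V := by
  obtain ⟨W, hWU, hW, hmax⟩ := exists_maximal_disjoint_translates D U hD
  obtain ⟨f, hf, hfR⟩ := exists_independent_transversal (ι := W)
    (fun w => (Q w).image (· * (w : Γ)))
    (fun v v' => ∃ g ∈ G, ∃ g' ∈ G, g * v = g' * v')
    (fun v v' ⟨g, hg, g', hg', h⟩ => ⟨g', hg', g, hg, h.symm⟩) (G.card ^ 2)
    (by have := hG.card_pos; positivity)
    (fun w => by
      rw [Finset.card_image_of_injective _ (mul_left_injective _)]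
      exact hQ w (hWU w.2))
    (by
      intro w w' x hx hx'
      obtain ⟨d, hd, rfl⟩ := Finset.mem_image.1 hx
      obtain ⟨d', hd', h⟩ := Finset.mem_image.1 hx'
      by_contra hne
      exact hW w w.2 w' w'.2 (fun e => hne (Subtype.ext e)) d (hQD _ hd) d' (hQD _ hd') h.symm)
    (by
      intro x
      refine ⟨(G ×ˢ G).image fun q => q.2⁻¹ * (q.1 * x), ?_, ?_⟩
      · refine Finset.card_image_le.trans ?_
        rw [Finset.card_product, sq]
      · rintro y ⟨g, hg, g', hg', h⟩
        refine Finset.mem_image.2 ⟨(g, g'), Finset.mem_product.2 ⟨hg, hg'⟩, ?_⟩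
        simp [h])
  refine ⟨Finset.univ.image f, ?_, ?_, ?_⟩
  · intro v hv
    obtain ⟨w, -, rfl⟩ := Finset.mem_image.1 hv
    obtain ⟨d, hd, h⟩ := Finset.mem_image.1 (hf w)
    exact ⟨w, hWU w.2, d, hd, h.symm⟩
  · intro v hv v' hv' hne g hg g' hg' h
    obtain ⟨w, -, rfl⟩ := Finset.mem_image.1 hv
    obtain ⟨w', -, rfl⟩ := Finset.mem_image.1 hv'
    exact hfR w w' (fun e => hne (by rw [e])) ⟨g, hg, g', hg', h⟩
  · intro u hu
    obtain ⟨w, hw, d, hd, d', hd', h⟩ := hmax u hu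
    obtain ⟨e, he, h'⟩ := Finset.mem_image.1 (hf ⟨w, hw⟩)
    -- By maximality `D * u` meets `D * w` for a selected `w`; `d'⁻¹ * d` leads from `u` to `w`, and
    -- `e` on to its chosen position.
    refine ⟨e * d'⁻¹ * d, ?_, ?_⟩
    · exact Finset.mul_mem_mul (Finset.mul_mem_mul (hQD _ he) (Finset.inv_mem_inv hd')) hd
    · refine Finset.mem_image.2 ⟨⟨w, hw⟩, Finset.mem_univ _, ?_⟩
      rw [← h', mul_assoc, h]
      simp [mul_assoc]

end Selection

/-! ### Extending partial colourings -/

section Coloring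

variable {Γ : Type*} [Group Γ] [Countable Γ]

/-- A partial proper `3`-colouring of the graph joining `h` to `γ * h` extends to a total one. -/
theorem exists_proper_coloring_extension (γ : Γ) (hγ : γ ≠ 1) (S : Set Γ) (f : Γ → Fin 3)
    (hf : ∀ h, h ∈ S → γ * h ∈ S → f (γ * h) ≠ f h) :
    ∃ f' : Γ → Fin 3, (∀ h ∈ S, f' h = f h) ∧ ∀ h, f' (γ * h) ≠ f' h := by
  classical
  obtain ⟨e, he⟩ := exists_injective_nat Γ
  have pick : ∀ a b : Fin 3, ∃ x, x ≠ a ∧ x ≠ b := by decide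
  choose pk hpk₁ hpk₂ using pick
  -- rank: points of `S` come first
  let rk : Γ → ℕ := fun h => if h ∈ S then 0 else e h + 1
  have hrk : ∀ h, h ∉ S → ∀ k, rk k = rk h → k = h := by
    intro h hh k hk
    by_cases hkS : k ∈ S
    · simp [rk, hh, hkS] at hk
    · simp only [rk, hh, hkS, if_false, Nat.add_right_cancel_iff] at hk
      exact he hk
  -- Greedy colouring: the graph has degree at most two, so three colours suffice. The value `0`
  -- stands for a neighbour not yet coloured.
  let step : ∀ h : Γ, (∀ k : Γ, rk k < rk h → Fin 3) → Fin 3 := fun h ih =>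
    if h ∈ S then f h else
      pk (if H : rk (γ * h) < rk h then ih _ H else 0) (if H : rk (γ⁻¹ * h) < rk h then ih _ H else 0)
  let wf : WellFounded (fun a b : Γ => rk a < rk b) := (measure rk).wf
  let f' : Γ → Fin 3 := wf.fix step
  have hf' : ∀ h, f' h = step h (fun k _ => f' k) := fun h => wf.fix_eq step h
  have hS : ∀ h ∈ S, f' h = f h := by
    intro h hh
    rw [hf' h]
    simp [step, hh]
  refine ⟨f', hS, ?_⟩
  have hne : ∀ h, γ * h ≠ h := fun h e => hγ (by simpa using e)
  intro h
  by_cases h₁ : h ∈ S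
  · by_cases h₂ : γ * h ∈ S
    · rw [hS _ h₁, hS _ h₂]; exact hf h h₁ h₂
    · have hlt : rk (γ⁻¹ * (γ * h)) < rk (γ * h) := by simp [rk, h₁, h₂]
      rw [hf' (γ * h)]
      simp only [step, h₂, if_false, hlt, dif_pos]
      have := hpk₂ (if H : rk (γ * (γ * h)) < rk (γ * h) then f' (γ * (γ * h)) else 0)
        (f' (γ⁻¹ * (γ * h)))
      rwa [inv_mul_cancel_left] at this ⊢
  · rcases lt_trichotomy (rk (γ * h)) (rk h) with hlt | heq | hgt
    · rw [hf' h]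
      simp only [step, h₁, if_false, hlt, dif_pos]
      exact (hpk₁ _ _).symm
    · exact absurd (hrk h h₁ _ heq) (hne h)
    · have h₂ : γ * h ∉ S := by
        intro h₂
        simp [rk, h₂] at hgt
      have hlt : rk (γ⁻¹ * (γ * h)) < rk (γ * h) := by simpa using hgt
      rw [hf' (γ * h)]
      simp only [step, h₂, if_false, hlt, dif_pos]
      have := hpk₂ (if H : rk (γ * (γ * h)) < rk (γ * h) then f' (γ * (γ * h)) else 0)
        (f' (γ⁻¹ * (γ * h)))
      rwa [inv_mul_cancel_left] at this ⊢

end Coloring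

/-! ### Levels, patches and saturated patterns -/

/-- One level of the construction: the support `F` of a pattern `p`, a margin `G` around it, and
a finite set `D` along which the pattern recurs. -/
structure Level (Γ : Type*) where
  F : Finset Γ
  G : Finset Γ
  D : Finset Γ
  p : ℕ → Γ → Fin 3

section Levels

variable {Γ : Type*} [Group Γ]

open scoped Classical in
/-- The `d ∈ D` for which the translate of the margin to `d * γ` lies in `A`. -/
noncomputable def Level.inside (l : Level Γ) (A : Finset Γ) (γ : Γ) : Finset Γ :=
  l.D.filter fun d => ∀ g ∈ l.G, g * (d * γ) ∈ A

open scoped Classical in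
/-- The `d ∈ D` for which the translate of the margin to `d * γ` is disjoint from `A`. -/
noncomputable def Level.outside (l : Level Γ) (A : Finset Γ) (γ : Γ) : Finset Γ :=
  l.D.filter fun d => ∀ g ∈ l.G, g * (d * γ) ∉ A

/-- From every point, many translates of the margin are not cut by `A`. -/
def Level.Respects (l : Level Γ) (A : Finset Γ) : Prop :=
  ∀ γ, 10 * l.G.card ^ 2 ≤ (l.inside A γ).card + (l.outside A γ).card

open scoped Pointwise Classical in
/-- The finite set of return times. -/
noncomputable def Level.returns (l : Level Γ) : Finset Γ := l.D * l.D⁻¹ * l.D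

/-- The configuration `p` contains, inside `F`, occurrences of the patterns of all levels `k < m`
near all points deep enough in `F`. -/
def Saturated (s : ℕ → Level Γ) (m : ℕ) (F : Finset Γ) (p : ℕ → Γ → Fin 3) : Prop :=
  ∀ k < m, ∀ γ, 5 * (s k).G.card ^ 2 ≤ ((s k).inside F γ).card →
    ∃ d ∈ (s k).returns, ∀ f ∈ (s k).F, f * (d * γ) ∈ F ∧
      ∀ i < k, p i (f * (d * γ)) = (s k).p i f

/-- Each layer `p i` is a proper colouring for left multiplication by `c i`. -/
def ProperLayers (c : ℕ → Γ) (p : ℕ → Γ → Fin 3) : Prop :=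
  ∀ i, c i ≠ 1 → ∀ h, p i (c i * h) ≠ p i h

/-- `absorb` makes the margin swallow every lower-level neighbourhood that touches the support, so
such a neighbourhood touches only one patch. The two multiplication laws prevent colouring conflicts
between different patches in the layers below `k`. -/
structure LevelLaws (c : ℕ → Γ) (s : ℕ → Level Γ) (k : ℕ) : Prop where
  one_mem : 1 ∈ (s k).F
  subset : (s k).F ⊆ (s k).G
  absorb : ∀ j < k, ∀ g ∈ (s j).G, ∀ d ∈ (s j).D, ∀ d' ∈ (s j).D, ∀ g' ∈ (s j).G,
    ∀ f ∈ (s k).F, g * d * d'⁻¹ * g'⁻¹ * f ∈ (s k).G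
  mul_mem : ∀ i < k, ∀ f ∈ (s k).F, c i * f ∈ (s k).G
  inv_mul_mem : ∀ i < k, ∀ f ∈ (s k).F, (c i)⁻¹ * f ∈ (s k).G
  proper : ProperLayers c (s k).p
  respects : ∀ j < k, (s j).Respects (s k).F
  saturated : Saturated s k (s k).F (s k).p

/-- A family `P` of patches `(k, v)`, the pattern of level `k` placed at `v`, inside `F`, which
takes care of the levels from `n` on. -/
structure IsPatching (s : ℕ → Level Γ) (m : ℕ) (F : Finset Γ) (n : ℕ) (P : Set (ℕ × Γ)) :
    Prop where
  lt : ∀ a ∈ P, a.1 < m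
  level : ∀ a ∈ P, n ≤ a.1 ∨ (a.1 + 1 = n ∧ a.2 = 1)
  margin : ∀ a ∈ P, ∀ g ∈ (s a.1).G, g * a.2 ∈ F
  separated : ∀ a ∈ P, ∀ b ∈ P, a ≠ b → a.1 ≤ b.1 → ∀ g ∈ (s a.1).G,
    g * a.2 * b.2⁻¹ ∉ (s b.1).F
  occurs : ∀ k, n ≤ k → k < m → ∀ γ, 5 * (s k).G.card ^ 2 ≤ ((s k).inside F γ).card →
    (∃ d ∈ (s k).returns, (k, d * γ) ∈ P) ∨
    ∃ b ∈ P, k < b.1 ∧ ∃ d ∈ (s k).returns, ∀ f ∈ (s k).F,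
      f * (d * γ) * b.2⁻¹ ∈ (s b.1).F ∧ ∀ i < k, (s b.1).p i (f * (d * γ) * b.2⁻¹) = (s k).p i f
  top : ∀ n', m = n' + 1 → (n', 1) ∈ P

theorem exists_isPatching_top (s : ℕ → Level Γ) (m : ℕ) (F : Finset Γ)
    (hcore : ∀ n, m = n + 1 → (s n).G ⊆ F) : ∃ P, IsPatching s m F m P := by
  refine ⟨{a | a.1 + 1 = m ∧ a.2 = 1}, ?_, ?_, ?_, ?_, ?_, ?_⟩
  · rintro a ⟨h, -⟩; omega
  · rintro a h; exact Or.inr h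
  · rintro a ⟨h, h'⟩ g hg
    rw [h', mul_one]; exact hcore _ h.symm hg
  · rintro ⟨a, v⟩ ⟨h, h'⟩ ⟨b, w⟩ ⟨k, k'⟩ hne
    simp only at h h' k k'
    exact absurd (Prod.ext (by simp only; omega) (by simp only; rw [h', k'])) hne
  · intro k h h'; omega
  · rintro n rfl; exact ⟨rfl, rfl⟩

open scoped Classical in
/-- The admissible `d ∈ D` for a new patch of level `n` at `d * γ`. -/
noncomputable def admissible (s : ℕ → Level Γ) (F : Finset Γ) (P : Set (ℕ × Γ)) (n : ℕ)
    (γ : Γ) : Finset Γ :=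
  ((s n).inside F γ).filter fun d =>
    (∀ b ∈ P, n < b.1 → ∀ g ∈ (s n).G, g * (d * γ) * b.2⁻¹ ∉ (s b.1).F) ∧
    ∀ g ∈ (s n).G, ∀ g' ∈ (s n).G, g * (d * γ) ≠ g'

/-- If the neighbourhood of `γ` touches a higher patch, it lies in the margin of that patch and
touches no other. Too many translates inside the patch would give an occurrence by saturation, so at
least half of the `10 * |G| ^ 2` uncut ones lie outside it. Avoiding the margin at the origin costs
at most `|G| ^ 2` more. -/
theorem card_admissible {c : ℕ → Γ} {s : ℕ → Level Γ} {m : ℕ} (laws : ∀ k < m, LevelLaws c s k)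
    {F : Finset Γ} {n : ℕ} {P : Set (ℕ × Γ)} (hP : IsPatching s m F (n + 1) P) (γ : Γ)
    (hγ : 5 * (s n).G.card ^ 2 ≤ ((s n).inside F γ).card)
    (hγP : ¬ ∃ b ∈ P, n < b.1 ∧ ∃ d ∈ (s n).returns, ∀ f ∈ (s n).F,
      f * (d * γ) * b.2⁻¹ ∈ (s b.1).F ∧
        ∀ i < n, (s b.1).p i (f * (d * γ) * b.2⁻¹) = (s n).p i f) :
    4 * (s n).G.card ^ 2 ≤ (admissible s F P n γ).card := by
  classical
  set Q := ((s n).inside F γ).filter fun d =>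
    (∀ b ∈ P, n < b.1 → ∀ g ∈ (s n).G, g * (d * γ) * b.2⁻¹ ∉ (s b.1).F) with hQ
  have h₁ : Q.card ≤ (admissible s F P n γ).card + (s n).G.card ^ 2 := by
    have : Q ⊆ admissible s F P n γ ∪
        ((s n).G ×ˢ (s n).G).image fun q => q.1⁻¹ * q.2 * γ⁻¹ := by
      intro d hd
      obtain ⟨hd₁, hd₂⟩ := Finset.mem_filter.1 hd
      by_cases h : ∀ g ∈ (s n).G, ∀ g' ∈ (s n).G, g * (d * γ) ≠ g'
      · exact Finset.mem_union_left _ (Finset.mem_filter.2 ⟨hd₁, hd₂, h⟩)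
      · push Not at h
        obtain ⟨g, hg, g', hg', h⟩ := h
        refine Finset.mem_union_right _ (Finset.mem_image.2
          ⟨(g, g'), Finset.mem_product.2 ⟨hg, hg'⟩, ?_⟩)
        simp only [← h]; group
    refine (Finset.card_le_card this).trans ((Finset.card_union_le _ _).trans ?_)
    refine Nat.add_le_add_left (Finset.card_image_le.trans ?_) _
    rw [Finset.card_product, sq]
  suffices h : 5 * (s n).G.card ^ 2 ≤ Q.card by omega
  by_cases h : ∃ b ∈ P, n < b.1 ∧ ∃ g ∈ (s n).G, ∃ d ∈ (s n).D, g * (d * γ) * b.2⁻¹ ∈ (s b.1).F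
  · obtain ⟨b, hbP, hnb, g₀, hg₀, d₀, hd₀, h₀⟩ := h
    have absorb : ∀ b ∈ P, n < b.1 → ∀ g ∈ (s n).G, ∀ d ∈ (s n).D,
        g * (d * γ) * b.2⁻¹ ∈ (s b.1).F → ∀ g' ∈ (s n).G, ∀ d' ∈ (s n).D,
        g' * (d' * γ) * b.2⁻¹ ∈ (s b.1).G := by
      intro b hb hnb g hg d hd h g' hg' d' hd'
      have := (laws _ (hP.lt b hb)).absorb n hnb g' hg' d' hd' d hd g hg _ h
      convert this using 1
      group
    have other : ∀ b' ∈ P, n < b'.1 → b' ≠ b → ∀ g ∈ (s n).G, ∀ d ∈ (s n).D,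
        g * (d * γ) * b'.2⁻¹ ∉ (s b'.1).F := by
      intro b' hb' hnb' hne g hg d hd h
      rcases le_total b.1 b'.1 with hle | hle
      · refine hP.separated b hbP b' hb' hne.symm hle _
          (absorb b hbP hnb g₀ hg₀ d₀ hd₀ h₀ g hg d hd) ?_
        rwa [inv_mul_cancel_right]
      · refine hP.separated b' hb' b hbP hne hle _
          (absorb b' hb' hnb' g hg d hd h g₀ hg₀ d₀ hd₀) ?_
        rwa [inv_mul_cancel_right]
    have hres := (laws _ (hP.lt b hbP)).respects n hnb (γ * b.2⁻¹)
    by_cases hin : 5 * (s n).G.card ^ 2 ≤ ((s n).inside (s b.1).F (γ * b.2⁻¹)).card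
    · exfalso
      obtain ⟨d, hd, h⟩ := (laws _ (hP.lt b hbP)).saturated n hnb _ hin
      refine hγP ⟨b, hbP, hnb, d, hd, ?_⟩
      intro f hf
      have := h f hf
      simpa only [mul_assoc] using this
    · have hout : 5 * (s n).G.card ^ 2 ≤ ((s n).outside (s b.1).F (γ * b.2⁻¹)).card := by omega
      refine hout.trans (Finset.card_le_card ?_)
      intro d hd
      obtain ⟨hdD, hd⟩ := Finset.mem_filter.1 hd
      refine Finset.mem_filter.2 ⟨Finset.mem_filter.2 ⟨hdD, ?_⟩, ?_⟩
      · intro g hg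
        have := hP.margin b hbP _ (absorb b hbP hnb g₀ hg₀ d₀ hd₀ h₀ g hg d hdD)
        rwa [inv_mul_cancel_right] at this
      · intro b' hb' hnb' g hg
        by_cases hbb : b' = b
        · subst hbb
          have := hd g hg
          simpa only [mul_assoc] using this
        · exact other b' hb' hnb' hbb g hg d hdD
  · push Not at h
    rw [hQ, Finset.filter_true_of_mem]
    · exact hγ
    · intro d hd b hb hnb g hg
      exact h b hb hnb g hg d (Finset.mem_filter.1 hd).1

theorem IsPatching.exists_pred {c : ℕ → Γ} {s : ℕ → Level Γ} {m : ℕ}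
    (laws : ∀ k < m, LevelLaws c s k) {F : Finset Γ} (hF : ∀ k < m, (s k).Respects F) {n : ℕ}
    (hn : n < m) {P : Set (ℕ × Γ)} (hP : IsPatching s m F (n + 1) P) :
    ∃ P', IsPatching s m F n P' := by
  classical
  open scoped Pointwise in
  have hG : (s n).G.Nonempty := ⟨1, (laws n hn).subset (laws n hn).one_mem⟩
  have hGc : 0 < (s n).G.card ^ 2 := by have := hG.card_pos; positivity
  have hD : (s n).D.Nonempty := by
    by_contra h
    have h' := Finset.not_nonempty_iff_eq_empty.1 h
    have := hF n hn 1
    simp only [Level.inside, Level.outside, h', Finset.filter_empty, Finset.card_empty] at this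
    omega
  let Sat : Γ → Prop := fun γ => ∃ b ∈ P, n < b.1 ∧ ∃ d ∈ (s n).returns, ∀ f ∈ (s n).F,
      f * (d * γ) * b.2⁻¹ ∈ (s b.1).F ∧ ∀ i < n, (s b.1).p i (f * (d * γ) * b.2⁻¹) = (s n).p i f
  let U := ((s n).D⁻¹ * (s n).G⁻¹ * F).filter fun γ =>
    5 * (s n).G.card ^ 2 ≤ ((s n).inside F γ).card ∧ ¬ Sat γ
  have hU : ∀ γ, 5 * (s n).G.card ^ 2 ≤ ((s n).inside F γ).card → ¬ Sat γ → γ ∈ U := by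
    intro γ h₁ h₂
    refine Finset.mem_filter.2 ⟨?_, h₁, h₂⟩
    obtain ⟨d, hd⟩ := Finset.card_pos.1 (show 0 < ((s n).inside F γ).card by omega)
    obtain ⟨hdD, hd⟩ := Finset.mem_filter.1 hd
    obtain ⟨g, hg⟩ := hG
    have := Finset.mul_mem_mul (Finset.mul_mem_mul (Finset.inv_mem_inv hdD)
      (Finset.inv_mem_inv hg)) (hd g hg)
    convert this using 1
    group
  have hsub : ∀ γ, admissible s F P n γ ⊆ (s n).D := fun γ =>
    (Finset.filter_subset _ _).trans (Finset.filter_subset _ _)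
  obtain ⟨V, hV, hVsep, hVsynd⟩ := exists_separated_syndetic (s n).G (s n).D U hG hD
    (admissible s F P n) hsub (fun γ hγ => by
      have hγ := (Finset.mem_filter.1 hγ).2
      exact card_admissible laws hP γ hγ.1 hγ.2)
  have hV' : ∀ v ∈ V, (∀ g ∈ (s n).G, g * v ∈ F) ∧
      (∀ b ∈ P, n < b.1 → ∀ g ∈ (s n).G, g * v * b.2⁻¹ ∉ (s b.1).F) ∧
      ∀ g ∈ (s n).G, ∀ g' ∈ (s n).G, g * v ≠ g' := by
    intro v hv
    obtain ⟨u, hu, d, hd, rfl⟩ := hV v hv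
    obtain ⟨hd₁, hd₂, hd₃⟩ := Finset.mem_filter.1 hd
    exact ⟨(Finset.mem_filter.1 hd₁).2, hd₂, hd₃⟩
  have hFG := (laws n hn).subset
  -- The exceptional patch at the origin has level `n` only at the first descent, `n + 1 = m`; it is
  -- why admissible positions also avoid the margin at `1`.
  have hold : ∀ a ∈ P, n < a.1 ∨ a = (n, 1) := by
    intro a ha
    rcases hP.level a ha with h | ⟨h, h'⟩
    · exact Or.inl (by omega)
    · exact Or.inr (Prod.ext (by simp only; omega) h')
  refine ⟨P ∪ {a | a.1 = n ∧ a.2 ∈ V}, ?_, ?_, ?_, ?_, ?_, ?_⟩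
  · rintro a (ha | ⟨rfl, -⟩)
    · exact hP.lt a ha
    · exact hn
  · rintro a (ha | ⟨rfl, -⟩)
    · rcases hold a ha with h | rfl
      · exact Or.inl h.le
      · exact Or.inl le_rfl
    · exact Or.inl le_rfl
  · rintro a (ha | ⟨rfl, ha⟩)
    · exact hP.margin a ha
    · exact (hV' _ ha).1
  · rintro a ha b hb hne hle g hg hmem
    rcases ha with ha | ⟨ha₁, ha₂⟩
    · rcases hb with hb | ⟨hb₁, hb₂⟩
      · exact hP.separated a ha b hb hne hle g hg hmem
      · rcases hold a ha with h | rfl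
        · omega
        · rw [hb₁] at hmem
          refine (hV' _ hb₂).2.2 _ (hFG hmem) g hg ?_
          simp
    · rw [ha₁] at hg
      rcases hb with hb | ⟨hb₁, hb₂⟩
      · rcases hold b hb with h | rfl
        · exact (hV' _ ha₂).2.1 b hb h g hg hmem
        · refine (hV' _ ha₂).2.2 g hg _ (hFG hmem) ?_
          simp
      · rw [hb₁] at hmem
        refine hVsep _ ha₂ _ hb₂ (fun h => hne (Prod.ext (ha₁.trans hb₁.symm) h)) g hg _
          (hFG hmem) ?_
        simp
  · intro k hnk hkm γ hγ
    rcases hnk.lt_or_eq with hlt | rfl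
    · rcases hP.occurs k hlt hkm γ hγ with ⟨d, hd, h⟩ | ⟨b, hb, h⟩
      · exact Or.inl ⟨d, hd, Or.inl h⟩
      · exact Or.inr ⟨b, Or.inl hb, h⟩
    · by_cases hs : Sat γ
      · obtain ⟨b, hb, h⟩ := hs
        exact Or.inr ⟨b, Or.inl hb, h⟩
      · obtain ⟨d, hd, h⟩ := hVsynd γ (hU γ hγ hs)
        exact Or.inl ⟨d, hd, Or.inr ⟨rfl, h⟩⟩
  · intro n' h
    exact Or.inl (hP.top n' h)

theorem exists_isPatching {c : ℕ → Γ} {s : ℕ → Level Γ} {m : ℕ}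
    (laws : ∀ k < m, LevelLaws c s k) {F : Finset Γ} (hF : ∀ k < m, (s k).Respects F)
    (hcore : ∀ n, m = n + 1 → (s n).G ⊆ F) : ∃ P, IsPatching s m F 0 P := by
  have key : ∀ j ≤ m, ∃ P, IsPatching s m F (m - j) P := by
    intro j
    induction j with
    | zero => intro _; exact exists_isPatching_top s m F hcore
    | succ j ih =>
      intro hj
      obtain ⟨P, hP⟩ := ih (by omega)
      have h : m - j = (m - (j + 1)) + 1 := by omega
      rw [h] at hP
      exact hP.exists_pred laws hF (by omega)
  simpa using key m le_rfl

/-- A finite set respected by all lower levels carries a saturated pattern. -/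
theorem exists_saturated [Countable Γ] {c : ℕ → Γ} {s : ℕ → Level Γ} {m : ℕ}
    (laws : ∀ k < m, LevelLaws c s k) {F : Finset Γ} (hF : ∀ k < m, (s k).Respects F)
    (hcore : ∀ n, m = n + 1 → (s n).G ⊆ F) :
    ∃ p, ProperLayers c p ∧ Saturated s m F p ∧
      ∀ n, m = n + 1 → ∀ f ∈ (s n).F, ∀ i < n, p i f = (s n).p i f := by
  classical
  obtain ⟨P, hP⟩ := exists_isPatching laws hF hcore
  have uniq : ∀ a ∈ P, ∀ b ∈ P, ∀ g, g * a.2⁻¹ ∈ (s a.1).F → g * b.2⁻¹ ∈ (s b.1).F → a = b := by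
    intro a ha b hb g hga hgb
    by_contra hne
    rcases le_total a.1 b.1 with h | h
    · refine hP.separated a ha b hb hne h _ ((laws _ (hP.lt a ha)).subset hga) ?_
      rwa [inv_mul_cancel_right]
    · refine hP.separated b hb a ha (Ne.symm hne) h _ ((laws _ (hP.lt b hb)).subset hgb) ?_
      rwa [inv_mul_cancel_right]
  have layer : ∀ i, ∃ q : Γ → Fin 3, (c i ≠ 1 → ∀ h, q (c i * h) ≠ q h) ∧
      ∀ a ∈ P, i < a.1 → ∀ g, g * a.2⁻¹ ∈ (s a.1).F → q g = (s a.1).p i (g * a.2⁻¹) := by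
    intro i
    let S : Set Γ := {g | ∃ a ∈ P, i < a.1 ∧ g * a.2⁻¹ ∈ (s a.1).F}
    let q₀ : Γ → Fin 3 := fun g =>
      if h : ∃ a ∈ P, i < a.1 ∧ g * a.2⁻¹ ∈ (s a.1).F then
        (s h.choose.1).p i (g * h.choose.2⁻¹) else 0
    have hq₀ : ∀ a ∈ P, i < a.1 → ∀ g, g * a.2⁻¹ ∈ (s a.1).F →
        q₀ g = (s a.1).p i (g * a.2⁻¹) := by
      intro a ha hi g hg
      have h : ∃ a ∈ P, i < a.1 ∧ g * a.2⁻¹ ∈ (s a.1).F := ⟨a, ha, hi, hg⟩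
      have h' : h.choose = a :=
        uniq _ h.choose_spec.1 a ha g h.choose_spec.2.2 hg
      simp only [q₀, dif_pos h, h']
    by_cases hc : c i = 1
    · exact ⟨q₀, fun h => absurd hc h, hq₀⟩
    obtain ⟨q, hqS, hq⟩ := exists_proper_coloring_extension (c i) hc S q₀ (by
      rintro h ⟨a, ha, hia, hga⟩ ⟨b, hb, hib, hgb⟩
      rw [hq₀ a ha hia h hga, hq₀ b hb hib _ hgb]
      -- An edge between two different patches would put a point of one support in the margin of the
      -- other patch, of level at most as high, contradicting separation.
      have hab : a = b := by
        by_contra hne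
        rcases le_total a.1 b.1 with hle | hle
        · refine hP.separated a ha b hb hne hle _
            ((laws _ (hP.lt a ha)).mul_mem i hia _ hga) ?_
          simpa only [mul_assoc, inv_mul_cancel_left, inv_mul_cancel, mul_one] using hgb
        · refine hP.separated b hb a ha (Ne.symm hne) hle _
            ((laws _ (hP.lt b hb)).inv_mul_mem i hib _ hgb) ?_
          simpa only [mul_assoc, inv_mul_cancel_left] using hga
      subst hab
      rw [mul_assoc]
      exact (laws _ (hP.lt a ha)).proper i hc _)
    exact ⟨q, fun _ => hq, fun a ha hi g hg => (hqS g ⟨a, ha, hi, hg⟩).trans (hq₀ a ha hi g hg)⟩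
  choose p hp hpP using layer
  refine ⟨p, hp, ?_, ?_⟩
  · intro k hk γ hγ
    rcases hP.occurs k (Nat.zero_le k) hk γ hγ with ⟨d, hd, h⟩ | ⟨b, hb, hkb, d, hd, h⟩
    · refine ⟨d, hd, fun f hf => ⟨hP.margin _ h _ ((laws k hk).subset hf), fun i hi => ?_⟩⟩
      have e : f * (d * γ) * (d * γ)⁻¹ = f := mul_inv_cancel_right _ _
      have := hpP i _ h hi (f * (d * γ)) (by simp only [e]; exact hf)
      simpa only [e] using this
    · refine ⟨d, hd, fun f hf => ⟨?_, fun i hi => ?_⟩⟩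
      · have := hP.margin b hb _ ((laws _ (hP.lt b hb)).subset (h f hf).1)
        rwa [inv_mul_cancel_right] at this
      · rw [hpP i b hb (hi.trans hkb) _ (h f hf).1]
        exact (h f hf).2 i hi
  · intro n hn f hf i hi
    have := hpP i _ (hP.top n hn) hi f (by simpa using hf)
    simpa using this

end Levels

/-! ### Finite sets that cut few translates -/

section Shapes

variable {Γ : Type*} [Group Γ]

open scoped Pointwise Classical in
/-- Every finite set can be enlarged, in a bounded way, to one respected by all levels `k < m`. -/
def HasShapes (s : ℕ → Level Γ) (m : ℕ) : Prop :=
  ∃ S : Finset Γ, ∀ A : Finset Γ, ∃ F, A ⊆ F ∧ F ⊆ S * A ∧ ∀ k < m, (s k).Respects F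

/-- In an infinite subgroup there are `n` elements with pairwise disjoint translates of `K`. -/
theorem exists_disjoint_translates (Δ : Subgroup Γ) (hΔ : (Δ : Set Γ).Infinite) (K : Finset Γ)
    (n : ℕ) : ∃ T : Finset Γ, T.card = n ∧ (∀ t ∈ T, t ∈ Δ) ∧
      ∀ t ∈ T, ∀ t' ∈ T, ∀ k ∈ K, ∀ k' ∈ K, k * t = k' * t' → t = t' := by
  classical
  open scoped Pointwise in
  induction n with
  | zero => exact ⟨∅, by simp, by simp, by simp⟩
  | succ n ih =>
    obtain ⟨T, hT, hTΔ, hdisj⟩ := ih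
    obtain ⟨a, haΔ, ha⟩ := hΔ.exists_notMem_finset (T ∪ K⁻¹ * (K * T))
    rw [Finset.mem_union, not_or] at ha
    have key : ∀ t ∈ T, ∀ k ∈ K, ∀ k' ∈ K, k * a ≠ k' * t := by
      intro t ht k hk k' hk' h
      apply ha.2
      have := Finset.mul_mem_mul (Finset.inv_mem_inv hk) (Finset.mul_mem_mul hk' ht)
      rwa [← h, inv_mul_cancel_left] at this
    refine ⟨insert a T, by rw [Finset.card_insert_of_notMem ha.1, hT], ?_, ?_⟩
    · intro t ht
      rcases Finset.mem_insert.1 ht with rfl | ht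
      · exact haΔ
      · exact hTΔ t ht
    · intro t ht t' ht' k hk k' hk' h
      rcases Finset.mem_insert.1 ht with rfl | h₁
      · rcases Finset.mem_insert.1 ht' with rfl | h₂
        · rfl
        · exact absurd h (key t' h₂ k hk k' hk')
      · rcases Finset.mem_insert.1 ht' with rfl | h₂
        · exact absurd h.symm (key t h₁ k' hk' k hk)
        · exact hdisj t h₁ t' h₂ k hk k' hk' h

-- Around a separated syndetic set of positions, each block `H * v` that meets `A` is added whole;
-- only then is the result enlarged for the old levels. As `H` contains `S⁻¹ * G`, that second
-- enlargement cannot reach `G * v` for a block that was left out.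
open scoped Pointwise Classical in
theorem HasShapes.exists_uncut {s : ℕ → Level Γ} {m : ℕ} (hs : HasShapes s m) (Δ : Subgroup Γ)
    (hΔ : (Δ : Set Γ).Infinite) (G : Finset Γ) (hG : 1 ∈ G) :
    ∃ K : Finset Γ, (∀ d ∈ K, d ∈ Δ) ∧ ∃ S : Finset Γ, ∀ A : Finset Γ, ∃ F, A ⊆ F ∧ F ⊆ S * A ∧
      (∀ k < m, (s k).Respects F) ∧
      ∀ γ, ∃ d ∈ K, (∀ g ∈ G, g * (d * γ) ∈ F) ∨ ∀ g ∈ G, g * (d * γ) ∉ F := by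
  obtain ⟨S, hS⟩ := hs
  let H : Finset Γ := G ∪ S⁻¹ * G
  have hGH : G ⊆ H := Finset.subset_union_left
  have hH : H.Nonempty := ⟨1, hGH hG⟩
  obtain ⟨L, hLΔ, hL⟩ := hΔ.exists_subset_card_eq (4 * H.card ^ 2)
  have hLne : L.Nonempty := by
    have := hH.card_pos
    refine Finset.card_pos.1 ?_
    rw [hL]; positivity
  have hLK : L ⊆ L * L⁻¹ * L := by
    intro d hd
    have := Finset.mul_mem_mul (Finset.mul_mem_mul hd (Finset.inv_mem_inv hd)) hd
    simpa using this
  refine ⟨L * L⁻¹ * L, ?_, S * (1 ∪ H * H⁻¹), ?_⟩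
  · intro d hd
    obtain ⟨x, hx, c, hc, rfl⟩ := Finset.mem_mul.1 hd
    obtain ⟨a, ha, b, hb, rfl⟩ := Finset.mem_mul.1 hx
    exact mul_mem (mul_mem (hLΔ ha) (by simpa using Δ.inv_mem (hLΔ (Finset.mem_inv'.1 hb))))
      (hLΔ hc)
  intro A
  let B := S * (1 ∪ H * H⁻¹) * A
  let Z := L⁻¹ * (G⁻¹ * B)
  obtain ⟨V, -, hVsep, hVsynd⟩ := exists_separated_syndetic H L Z hH hLne (fun _ => L)
    (fun _ => subset_rfl) (fun _ _ => hL.ge)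
  let A' := A ∪ (V.filter fun v => ∃ h ∈ H, h * v ∈ A).biUnion fun v => H.image (· * v)
  have hA' : A' ⊆ (1 ∪ H * H⁻¹) * A := by
    intro x hx
    rcases Finset.mem_union.1 hx with hx | hx
    · have := Finset.mul_mem_mul (Finset.mem_union_left (H * H⁻¹) (Finset.mem_one.2 rfl)) hx
      rwa [one_mul] at this
    · obtain ⟨v, hv, hx⟩ := Finset.mem_biUnion.1 hx
      obtain ⟨h, hh, rfl⟩ := Finset.mem_image.1 hx
      obtain ⟨-, h', hh', hA⟩ := Finset.mem_filter.1 hv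
      have := Finset.mul_mem_mul (Finset.mem_union_right 1
        (Finset.mul_mem_mul hh (Finset.inv_mem_inv hh'))) hA
      convert this using 1
      group
  obtain ⟨F, hAF, hFS, hF⟩ := hS A'
  have hFB : F ⊆ B := by
    refine hFS.trans ?_
    simp only [B, mul_assoc]
    exact Finset.mul_subset_mul_left hA'
  refine ⟨F, Finset.subset_union_left.trans hAF, hFB, hF, ?_⟩
  intro γ
  by_cases hγ : γ ∈ Z
  · obtain ⟨d, hd, hv⟩ := hVsynd γ hγ
    refine ⟨d, hd, ?_⟩
    set v := d * γ
    by_cases hvA : ∃ h ∈ H, h * v ∈ A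
    · left
      intro g hg
      refine hAF (Finset.mem_union_right _ (Finset.mem_biUnion.2
        ⟨v, Finset.mem_filter.2 ⟨hv, hvA⟩, Finset.mem_image_of_mem _ (hGH hg)⟩))
    · right
      intro g hg hgF
      obtain ⟨σ, hσ, a, ha, h⟩ := Finset.mem_mul.1 (hFS hgF)
      have haH : σ⁻¹ * g ∈ H :=
        Finset.mem_union_right _ (Finset.mul_mem_mul (Finset.inv_mem_inv hσ) hg)
      have hav : a = σ⁻¹ * g * v := by
        rw [mul_assoc, ← h, inv_mul_cancel_left]
      rcases Finset.mem_union.1 ha with ha | ha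
      · exact hvA ⟨_, haH, hav ▸ ha⟩
      · obtain ⟨w, hw, ha⟩ := Finset.mem_biUnion.1 ha
        obtain ⟨h', hh', hw'⟩ := Finset.mem_image.1 ha
        obtain ⟨hwV, hwA⟩ := Finset.mem_filter.1 hw
        by_cases hwv : w = v
        · exact hvA (hwv ▸ hwA)
        · exact hVsep w hwV v hv hwv h' hh' _ haH (hw'.trans hav)
  -- Here `γ` is so far from `B`, hence from `F`, that every `d ∈ L` gives a translate outside.
  · obtain ⟨d, hd⟩ := hLne
    refine ⟨d, hLK hd, Or.inr fun g hg hgF => hγ ?_⟩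
    have := Finset.mul_mem_mul (Finset.inv_mem_inv hd)
      (Finset.mul_mem_mul (Finset.inv_mem_inv hg) (hFB hgF))
    convert this using 1
    group

open scoped Pointwise Classical in
/-- The set `D` of a new level can be chosen so that shapes exist for one more level. -/
theorem HasShapes.exists_returns {s : ℕ → Level Γ} {m : ℕ} (hs : HasShapes s m) (Δ : Subgroup Γ)
    (hΔ : (Δ : Set Γ).Infinite) (G : Finset Γ) (hG : 1 ∈ G) :
    ∃ D : Finset Γ, (∀ d ∈ D, d ∈ Δ) ∧ ∃ S : Finset Γ, ∀ A : Finset Γ, ∃ F, A ⊆ F ∧ F ⊆ S * A ∧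
      (∀ k < m, (s k).Respects F) ∧
      ∀ γ, 10 * G.card ^ 2 ≤ (D.filter fun d => ∀ g ∈ G, g * (d * γ) ∈ F).card +
        (D.filter fun d => ∀ g ∈ G, g * (d * γ) ∉ F).card := by
  obtain ⟨K, hK, S, hS⟩ := hs.exists_uncut Δ hΔ G hG
  obtain ⟨T, hT, hTΔ, hdisj⟩ := exists_disjoint_translates Δ hΔ K (10 * G.card ^ 2)
  refine ⟨K * T, ?_, S, ?_⟩
  · intro d hd
    obtain ⟨k, hk, t, ht, rfl⟩ := Finset.mem_mul.1 hd
    exact mul_mem (hK k hk) (hTΔ t ht)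
  intro A
  obtain ⟨F, hAF, hFS, hF, hcut⟩ := hS A
  refine ⟨F, hAF, hFS, hF, ?_⟩
  intro γ
  rw [← hT]
  refine le_trans ?_ (Finset.card_union_le _ _)
  -- One uncut translate is found from each `t * γ`; disjointness of the sets `K * t` makes the
  -- elements `d t * t` distinct.
  choose d hdK hd using fun t => hcut (t * γ)
  refine Finset.card_le_card_of_injOn (fun t => d t * t) ?_ ?_
  · intro t ht
    have hmem : d t * t ∈ K * T := Finset.mul_mem_mul (hdK t) ht
    rcases hd t with h | h
    · refine Finset.mem_union_left _ (Finset.mem_filter.2 ⟨hmem, ?_⟩)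
      intro g hg
      simpa only [mul_assoc] using h g hg
    · refine Finset.mem_union_right _ (Finset.mem_filter.2 ⟨hmem, ?_⟩)
      intro g hg
      simpa only [mul_assoc] using h g hg
  · intro t ht t' ht' h
    exact hdisj t ht t' ht' _ (hdK t) _ (hdK t') h

end Shapes

/-! ### The sequence of levels and its limit -/

section Construction

variable {Γ : Type*} [Group Γ]

/-- The properties of the level `k` that involve the previous levels. -/
structure IsStage (c : ℕ → Γ) (e : ℕ → Γ) (Δ : ℕ → Subgroup Γ) (s : ℕ → Level Γ) (k : ℕ) :
    Prop where
  laws : LevelLaws c s k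
  mem : ∀ d ∈ (s k).D, d ∈ Δ k
  shapes : HasShapes s (k + 1)
  enum_mem : e k ∈ (s k).F
  subset : ∀ n, k = n + 1 → (s n).F ⊆ (s k).F
  agree : ∀ n, k = n + 1 → ∀ f ∈ (s n).F, ∀ i < n, (s k).p i f = (s n).p i f

theorem Saturated.congr {s t : ℕ → Level Γ} {m : ℕ} (h : ∀ k < m, s k = t k) {F : Finset Γ}
    {p : ℕ → Γ → Fin 3} (hs : Saturated s m F p) : Saturated t m F p := by
  intro k hk
  rw [← h k hk]
  exact hs k hk

theorem HasShapes.congr {s t : ℕ → Level Γ} {m : ℕ} (h : ∀ k < m, s k = t k)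
    (hs : HasShapes s m) : HasShapes t m := by
  obtain ⟨S, hS⟩ := hs
  refine ⟨S, fun A => ?_⟩
  obtain ⟨F, h₁, h₂, h₃⟩ := hS A
  exact ⟨F, h₁, h₂, fun k hk => h k hk ▸ h₃ k hk⟩

theorem LevelLaws.congr {c : ℕ → Γ} {s t : ℕ → Level Γ} {k : ℕ} (h : ∀ j ≤ k, s j = t j)
    (hs : LevelLaws c s k) : LevelLaws c t k := by
  have hk := h k le_rfl
  have hj : ∀ j < k, s j = t j := fun j hj => h j hj.le
  refine ⟨hk ▸ hs.one_mem, hk ▸ hs.subset, ?_, hk ▸ hs.mul_mem, hk ▸ hs.inv_mul_mem,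
    hk ▸ hs.proper, ?_, ?_⟩
  · intro j hjk
    rw [← hk, ← hj j hjk]
    exact hs.absorb j hjk
  · intro j hjk
    rw [← hk, ← hj j hjk]
    exact hs.respects j hjk
  · rw [← hk]
    exact hs.saturated.congr hj

theorem IsStage.congr {c e : ℕ → Γ} {Δ : ℕ → Subgroup Γ} {s t : ℕ → Level Γ} {k : ℕ}
    (h : ∀ j ≤ k, s j = t j) (hs : IsStage c e Δ s k) : IsStage c e Δ t k := by
  have hk := h k le_rfl
  refine ⟨hs.laws.congr h, hk ▸ hs.mem, hs.shapes.congr fun j hj => h j (by omega),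
    hk ▸ hs.enum_mem, ?_, ?_⟩
  · intro n hn
    rw [← hk, ← h n (by omega)]
    exact hs.subset n hn
  · intro n hn
    rw [← hk, ← h n (by omega)]
    exact hs.agree n hn

open scoped Pointwise Classical in
theorem exists_next_level [Countable Γ] (c e : ℕ → Γ) (Δ : ℕ → Subgroup Γ)
    (hΔ : ∀ n, (Δ n : Set Γ).Infinite) (s : ℕ → Level Γ) (m : ℕ)
    (hs : ∀ k < m, IsStage c e Δ s k) :
    ∃ l : Level Γ, IsStage c e Δ (Function.update s m l) m := by
  have hshapes : HasShapes s m := by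
    cases m with
    | zero => exact ⟨1, fun A => ⟨A, subset_rfl, by simp, by simp⟩⟩
    | succ n => exact (hs n n.lt_succ_self).shapes
  have hshapes' := hshapes
  obtain ⟨S, hS⟩ := hshapes
  -- Including `e m` makes the supports exhaust `Γ`; including the earlier margins lets the previous
  -- pattern sit at the origin.
  obtain ⟨F, hAF, -, hF⟩ := hS ({1, e m} ∪ (Finset.range m).biUnion fun n => (s n).G)
  have laws : ∀ k < m, LevelLaws c s k := fun k hk => (hs k hk).laws
  have hcore : ∀ n, m = n + 1 → (s n).G ⊆ F := by
    rintro n rfl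
    refine (Finset.subset_biUnion_of_mem (fun n => (s n).G)
      (Finset.mem_range.2 n.lt_succ_self)).trans (Finset.subset_union_right.trans hAF)
  obtain ⟨p, hp, hsat, hagree⟩ := exists_saturated laws hF hcore
  let G : Finset Γ := F ∪ ((Finset.range m).biUnion fun j =>
      (s j).G * (s j).D * (s j).D⁻¹ * (s j).G⁻¹ * F) ∪
    (Finset.range m).biUnion fun i => {c i, (c i)⁻¹} * F
  have hFG : F ⊆ G := Finset.subset_union_left.trans Finset.subset_union_left
  have h1F : 1 ∈ F := hAF (Finset.mem_union_left _ (by simp))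
  obtain ⟨D, hD, S', hS'⟩ := hshapes'.exists_returns (Δ m) (hΔ m) G (hFG h1F)
  let t := Function.update s m ⟨F, G, D, p⟩
  have htm : t m = ⟨F, G, D, p⟩ := Function.update_self _ _ _
  have htk : ∀ k < m, t k = s k := fun k hk => Function.update_of_ne hk.ne _ _
  refine ⟨⟨F, G, D, p⟩, ?_⟩
  change IsStage c e Δ t m
  refine ⟨⟨?_, ?_, ?_, ?_, ?_, ?_, ?_, ?_⟩, ?_, ?_, ?_, ?_, ?_⟩
  · rw [htm]; exact h1F
  · rw [htm]; exact hFG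
  · intro j hj g hg d hd d' hd' g' hg' f hf
    rw [htk j hj] at hg hd hd' hg'
    rw [htm] at hf ⊢
    refine Finset.mem_union_left _ (Finset.mem_union_right _ (Finset.mem_biUnion.2
      ⟨j, Finset.mem_range.2 hj, ?_⟩))
    exact Finset.mul_mem_mul (Finset.mul_mem_mul (Finset.mul_mem_mul (Finset.mul_mem_mul hg hd)
      (Finset.inv_mem_inv hd')) (Finset.inv_mem_inv hg')) hf
  · intro i hi f hf
    rw [htm] at hf ⊢
    exact Finset.mem_union_right _ (Finset.mem_biUnion.2
      ⟨i, Finset.mem_range.2 hi, Finset.mul_mem_mul (by simp) hf⟩)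
  · intro i hi f hf
    rw [htm] at hf ⊢
    exact Finset.mem_union_right _ (Finset.mem_biUnion.2
      ⟨i, Finset.mem_range.2 hi, Finset.mul_mem_mul (by simp) hf⟩)
  · rw [htm]; exact hp
  · intro j hj
    rw [htm, htk j hj]; exact hF j hj
  · rw [htm]
    exact hsat.congr fun k hk => (htk k hk).symm
  · rw [htm]; exact hD
  · refine ⟨S', fun A => ?_⟩
    obtain ⟨F', h₁, h₂, h₃, h₄⟩ := hS' A
    refine ⟨F', h₁, h₂, fun k hk => ?_⟩
    rcases (Nat.lt_succ_iff.1 hk).lt_or_eq with hk | rfl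
    · rw [htk k hk]; exact h₃ k hk
    · rw [htm]; exact h₄
  · rw [htm]; exact hAF (Finset.mem_union_left _ (by simp))
  · intro n hn
    rw [htm, htk n (by omega)]
    exact ((laws n (by omega)).subset).trans (hcore n hn)
  · intro n hn
    rw [htm, htk n (by omega)]
    exact hagree n hn

theorem exists_levels [Countable Γ] (c e : ℕ → Γ) (Δ : ℕ → Subgroup Γ)
    (hΔ : ∀ n, (Δ n : Set Γ).Infinite) : ∃ s : ℕ → Level Γ, ∀ k, IsStage c e Δ s k := by
  classical
  let St (n : ℕ) := {s : ℕ → Level Γ // ∀ k < n, IsStage c e Δ s k}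
  have next : ∀ n (s : St n), ∃ t : St (n + 1), ∀ k < n, t.1 k = s.1 k := by
    rintro n ⟨s, hs⟩
    obtain ⟨l, hl⟩ := exists_next_level c e Δ hΔ s n hs
    refine ⟨⟨Function.update s n l, fun k hk => ?_⟩, fun k hk => Function.update_of_ne hk.ne _ _⟩
    rcases (Nat.lt_succ_iff.1 hk).lt_or_eq with hk | rfl
    · exact (hs k hk).congr fun j hj =>
        (Function.update_of_ne (lt_of_le_of_lt hj hk).ne _ _).symm
    · exact hl
  choose nx hnx using next
  let seq : ∀ n, St n := fun n =>
    Nat.rec (motive := St) ⟨fun _ => ⟨∅, ∅, ∅, fun _ _ => 0⟩, by simp⟩ nx n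
  have hseq : ∀ n, seq (n + 1) = nx n (seq n) := fun n => rfl
  have hstab : ∀ k n, k < n → (seq n).1 k = (seq (k + 1)).1 k := by
    intro k n hkn
    induction n, hkn using Nat.le_induction with
    | base => rfl
    | succ n hn ih => rw [hseq n, hnx n _ k hn, ih]
  refine ⟨fun k => (seq (k + 1)).1 k, fun k => ?_⟩
  refine ((seq (k + 1)).2 k k.lt_succ_self).congr fun j hj => ?_
  exact hstab j (k + 1) (by omega)

/-- There is a configuration with properly coloured layers in which the restriction to the `n`-th
window recurs along a finite subset of `Δ n` from every point. -/
theorem exists_recurrent_configuration [Countable Γ] (c : ℕ → Γ) (Δ : ℕ → Subgroup Γ)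
    (hΔ : ∀ n, (Δ n : Set Γ).Infinite) :
    ∃ x : ℕ → Γ → Fin 3, ProperLayers c x ∧ ∃ W : ℕ → Finset Γ,
      (∀ K : Finset Γ, ∃ N, ∀ n, N ≤ n → K ⊆ W n) ∧
      ∀ n, ∃ D : Finset Γ, (∀ d ∈ D, d ∈ Δ n) ∧
        ∀ γ, ∃ d ∈ D, ∀ f ∈ W n, ∀ i < n, x i (f * (d * γ)) = x i f := by
  classical
  obtain ⟨e, he⟩ := exists_surjective_nat Γ
  obtain ⟨s, hs⟩ := exists_levels c e Δ hΔ
  have hmono : Monotone fun n => (s n).F :=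
    monotone_nat_of_le_succ fun n => (hs (n + 1)).subset n rfl
  have hexh : ∀ K : Finset Γ, ∃ N, ∀ n, N ≤ n → K ⊆ (s n).F := by
    intro K
    induction K using Finset.induction_on with
    | empty => exact ⟨0, by simp⟩
    | insert a K ha ih =>
      obtain ⟨N, hN⟩ := ih
      obtain ⟨k, rfl⟩ := he a
      refine ⟨max N k, fun n hn => Finset.insert_subset ?_ (hN n (le_of_max_le_left hn))⟩
      exact hmono (le_of_max_le_right hn) (hs k).enum_mem
  have hagree : ∀ n m, n ≤ m → ∀ f ∈ (s n).F, ∀ i < n, (s m).p i f = (s n).p i f := by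
    intro n m hnm f hf i hi
    induction m, hnm using Nat.le_induction with
    | base => rfl
    | succ m hm ih =>
      rw [(hs (m + 1)).agree m rfl f (hmono hm hf) i (by omega), ih]
  have hex : ∀ (i : ℕ) (g : Γ), ∃ n, i < n ∧ g ∈ (s n).F := by
    intro i g
    obtain ⟨N, hN⟩ := hexh {g}
    exact ⟨max N (i + 1), by omega, hN _ (le_max_left _ _) (Finset.mem_singleton_self g)⟩
  choose N hN hNF using hex
  let x : ℕ → Γ → Fin 3 := fun i g => (s (N i g)).p i g
  have hx : ∀ n i g, i < n → g ∈ (s n).F → x i g = (s n).p i g := by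
    intro n i g hi hg
    have h₁ := hagree (N i g) (max (N i g) n) (le_max_left _ _) g (hNF i g) i (hN i g)
    have h₂ := hagree n (max (N i g) n) (le_max_right _ _) g hg i hi
    exact h₁.symm.trans h₂
  refine ⟨x, ?_, fun n => (s n).F, hexh, ?_⟩
  · intro i hi h
    obtain ⟨M, hM⟩ := hexh {h, c i * h}
    have hM' := hM (max M (i + 1)) (le_max_left _ _)
    rw [hx (max M (i + 1)) i _ (by omega) (hM' (by simp)),
      hx (max M (i + 1)) i _ (by omega) (hM' (by simp))]
    exact (hs _).laws.proper i hi h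
  · intro n
    refine ⟨(s n).returns, ?_, ?_⟩
    · intro d hd
      unfold Level.returns at hd
      obtain ⟨y, hy, z, hz, rfl⟩ := Finset.mem_mul.1 hd
      obtain ⟨a, ha, b, hb, rfl⟩ := Finset.mem_mul.1 hy
      have hb' := (Δ n).inv_mem ((hs n).mem _ (Finset.mem_inv'.1 hb))
      rw [inv_inv] at hb'
      exact mul_mem (mul_mem ((hs n).mem a ha) hb') ((hs n).mem z hz)
    · intro γ
      obtain ⟨M, hM⟩ := hexh (((s n).G ×ˢ (s n).D).image fun q => q.1 * (q.2 * γ))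
      let m := max M (n + 1)
      have hnm : n < m := by omega
      have hin : (s n).inside (s m).F γ = (s n).D := by
        refine Finset.filter_true_of_mem fun d hd g hg => ?_
        exact hM m (le_max_left _ _)
          (Finset.mem_image.2 ⟨(g, d), Finset.mem_product.2 ⟨hg, hd⟩, rfl⟩)
      -- The inside and outside counts are each at most `|D|`, so `Respects` forces `|D| ≥ 5 * |G| ^
      -- 2`; here all of `D` is inside.
      have hcard : 5 * (s n).G.card ^ 2 ≤ ((s n).inside (s m).F γ).card := by
        rw [hin]
        have h := (hs m).laws.respects n hnm γ
        have h₁ : ((s n).inside (s m).F γ).card ≤ (s n).D.card :=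
          Finset.card_le_card (Finset.filter_subset _ _)
        have h₂ : ((s n).outside (s m).F γ).card ≤ (s n).D.card :=
          Finset.card_le_card (Finset.filter_subset _ _)
        omega
      obtain ⟨d, hd, h⟩ := (hs m).laws.saturated n hnm γ hcard
      refine ⟨d, hd, fun f hf i hi => ?_⟩
      rw [hx m i _ (hi.trans hnm) (h f hf).1, (h f hf).2 i hi, hx n i f hi hf]

end Construction

/-! ### Orbit closures and the theorem -/

section Flow

/-- The right shift on configurations of `ℕ` layers over `Γ`, with `Γ` enumerated by `e`. -/
@[reducible]
def shiftAction {Γ : Type u} [Group Γ] (e : Γ ≃ ℕ) (A : Type v) : MulAction Γ (ℕ × ℕ → A) where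
  smul γ y := fun q => y (q.1, e (e.symm q.2 * γ))
  one_smul y := by
    funext q
    change y (q.1, e (e.symm q.2 * 1)) = y q
    simp
  mul_smul γ δ y := by
    funext q
    change y (q.1, e (e.symm q.2 * (γ * δ))) =
      y (q.1, e (e.symm (e (e.symm q.2 * γ)) * δ))
    simp [mul_assoc]

theorem IsMinimalFor.mono {Γ : Type u} [Group Γ] {S T : Set Γ} (h : S ⊆ T) {X : Type v}
    [TopologicalSpace X] [MulAction Γ X] (hS : IsMinimalFor S X) : IsMinimalFor T X :=
  fun x => (hS x).mono (Set.image_mono h)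

theorem agree_mem_nhds {ι A : Type*} [TopologicalSpace A] [DiscreteTopology A] (I : Finset ι)
    (y : ι → A) : {w : ι → A | ∀ q ∈ I, w q = y q} ∈ nhds y := by
  have : {w : ι → A | ∀ q ∈ I, w q = y q} = (I : Set ι).pi fun q => {y q} := by
    ext w; simp [Set.mem_pi]
  rw [this]
  exact set_pi_mem_nhds I.finite_toSet fun q _ => (isOpen_discrete _).mem_nhds rfl

/-- The orbit closure of a configuration which recurs along all conjugates of the subgroups `Δ n`
is minimal for all `Δ n`, and free when the layers are properly coloured. -/
theorem exists_flow_of_sequence (Γ : Type u) [Group Γ] [Countable Γ] [Infinite Γ]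
    (Δ : ℕ → Subgroup Γ) (hΔ : ∀ n, (Δ n : Set Γ).Infinite) :
    ∃ (X : Type v) (_ : TopologicalSpace X) (_ : MulAction Γ X),
      IsFlow Γ X ∧ IsFreeAction Γ X ∧ ∀ n, IsMinimalFor (Δ n : Set Γ) X := by
  classical
  obtain ⟨e⟩ : Nonempty (Γ ≃ ℕ) := nonempty_equiv_of_countable
  obtain ⟨r, hr⟩ := exists_surjective_nat (ℕ × Γ)
  obtain ⟨c, hc⟩ := exists_surjective_nat Γ
  -- Returning to the pattern of the translate `h • x` along `Δ n` amounts to recurrence of `x`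
  -- along `h⁻¹ * Δ n * h`.
  let conj : ℕ × Γ → Subgroup Γ := fun q => (Δ q.1).map (MulAut.conj q.2⁻¹).toMonoidHom
  obtain ⟨x₀, hx₀, W, hW, hrec⟩ := exists_recurrent_configuration c
    (fun m => conj (r m.unpair.1)) (by
      intro m
      simp only [conj, Subgroup.coe_map]
      exact (hΔ _).image (MulEquiv.injective _).injOn)
  let A := ULift.{v} (Fin 3)
  let act : MulAction Γ (ℕ × ℕ → A) := shiftAction e A
  have smul_apply : ∀ (γ : Γ) (y : ℕ × ℕ → A) q, (γ • y) q = y (q.1, e (e.symm q.2 * γ)) :=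
    fun _ _ _ => rfl
  have hcont : ∀ γ : Γ, Continuous fun y : ℕ × ℕ → A => γ • y := fun γ =>
    continuous_pi fun q => continuous_apply (q.1, e (e.symm q.2 * γ))
  let x : ℕ × ℕ → A := fun q => ⟨x₀ q.1 (e.symm q.2)⟩
  let O : Set (ℕ × ℕ → A) := Set.range fun γ : Γ => γ • x
  have hinv : ∀ (γ : Γ), ∀ y ∈ closure O, γ • y ∈ closure O := by
    intro γ y hy
    refine map_mem_closure (hcont γ) hy ?_
    rintro _ ⟨δ, rfl⟩
    exact ⟨γ * δ, mul_smul γ δ x⟩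
  let X := {y // y ∈ closure O}
  let actX : MulAction Γ X :=
    { smul := fun γ y => ⟨γ • y.1, hinv γ y.1 y.2⟩
      one_smul := fun y => Subtype.ext (one_smul Γ y.1)
      mul_smul := fun γ δ y => Subtype.ext (mul_smul γ δ y.1) }
  have coe_smul : ∀ (γ : Γ) (y : X), ((γ • y : X) : ℕ × ℕ → A) = γ • y.1 := fun _ _ => rfl
  refine ⟨X, inferInstance, actX, ⟨?_, ?_, ?_, ⟨fun γ => ?_⟩⟩, ?_, ?_⟩
  · exact ⟨⟨x, subset_closure ⟨1, one_smul Γ x⟩⟩⟩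
  · exact isCompact_iff_compactSpace.1 isClosed_closure.isCompact
  · infer_instance
  · exact ((hcont γ).comp continuous_subtype_val).subtype_mk _
  · intro y
    rw [Subgroup.eq_bot_iff_forall]
    intro γ hγ
    by_contra hne
    obtain ⟨i, rfl⟩ := hc γ
    have hclosed : IsClosed {w : ℕ × ℕ → A | w (i, e (c i)) ≠ w (i, e 1)} := by
      have hpair : Continuous fun w : ℕ × ℕ → A => (w (i, e (c i)), w (i, e 1)) := by fun_prop
      exact (isClosed_discrete {p : A × A | p.1 ≠ p.2}).preimage hpair
    have hsub : closure O ⊆ {w : ℕ × ℕ → A | w (i, e (c i)) ≠ w (i, e 1)} := by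
      refine closure_minimal ?_ hclosed
      rintro _ ⟨h, rfl⟩ heq
      simp only [smul_apply, Equiv.symm_apply_apply, one_mul, x] at heq
      exact hx₀ i hne h (ULift.up_injective heq)
    refine hsub y.2 ?_
    have h := congrFun (congrArg Subtype.val (MulAction.mem_stabilizer_iff.1 hγ)) (i, e 1)
    rw [coe_smul, smul_apply] at h
    simpa using h
  · intro n y
    rw [dense_iff_inter_open]
    rintro U hU ⟨z, hz⟩
    obtain ⟨V, hV, rfl⟩ := isOpen_induced_iff.1 hU
    obtain ⟨_, hhV, h, rfl⟩ := mem_closure_iff.1 z.2 V hV hz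
    obtain ⟨I, u, hu, hIV⟩ := isOpen_pi_iff.1 hV _ hhV
    obtain ⟨N, hN⟩ := hW (I.image fun q => e.symm q.2 * h)
    obtain ⟨a, ha⟩ := hr (n, h)
    -- The first coordinate selects the conjugate; the second makes `m` large enough for the window
    -- and the layers in `I`.
    let m := Nat.pair a (max N (I.sup Prod.fst + 1))
    have hm : max N (I.sup Prod.fst + 1) ≤ m := Nat.right_le_pair _ _
    obtain ⟨D, hD, hrecD⟩ := hrec m
    have hDΔ : ∀ d ∈ D, h * d * h⁻¹ ∈ Δ n := by
      intro d hd
      have := hD d hd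
      simp only [m, Nat.unpair_pair, ha, conj] at this
      obtain ⟨δ, hδ, rfl⟩ := Subgroup.mem_map.1 this
      simpa [mul_assoc] using hδ
    obtain ⟨_, hw, γ, rfl⟩ := mem_closure_iff_nhds.1 y.2 _ (agree_mem_nhds
      ((I ×ˢ D).image fun q => (q.1.1, e (e.symm q.1.2 * (h * q.2 * h⁻¹)))) y.1)
    obtain ⟨d, hd, hdx⟩ := hrecD (h⁻¹ * γ)
    refine ⟨(h * d * h⁻¹) • y, ?_, Set.mem_image_of_mem _ (hDΔ d hd)⟩
    refine hIV fun q hq => ?_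
    have h₁ := hw _ (Finset.mem_image.2 ⟨(q, d), Finset.mem_product.2 ⟨hq, hd⟩, rfl⟩)
    have hi : q.1 < m := by
      have := Finset.le_sup (f := Prod.fst) hq
      omega
    have h₂ := hdx (e.symm q.2 * h) (hN m (le_trans (le_max_left _ _) hm)
      (Finset.mem_image_of_mem _ hq)) q.1 hi
    have h₃ : ((h * d * h⁻¹) • y).1 q = (h • x) q := by
      rw [coe_smul, smul_apply, ← h₁]
      simp only [smul_apply, Equiv.symm_apply_apply, x]
      rw [← h₂]
      congr 2
      group
    rw [h₃]
    exact (hu q hq).2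

/-- Adding `⊤`, infinite because `Γ` is, makes the family nonempty and hence the range of a
sequence. -/
theorem exists_flow_of_countable {Γ : Type u} [Group Γ] [Countable Γ] [Infinite Γ]
    {𝓕 : Set (Subgroup Γ)} (h𝓕 : 𝓕.Countable) (hinf : ∀ Δ ∈ 𝓕, (Δ : Set Γ).Infinite) :
    ∃ (X : Type v) (_ : TopologicalSpace X) (_ : MulAction Γ X),
      IsFlow Γ X ∧ IsFreeAction Γ X ∧ ∀ Δ ∈ 𝓕, IsMinimalFor (Δ : Set Γ) X := by
  obtain ⟨Δ, hΔ⟩ := (h𝓕.insert ⊤).exists_eq_range (Set.insert_nonempty _ _)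
  obtain ⟨X, t, a, hX, hfree, hmin⟩ := exists_flow_of_sequence.{u, v} Γ Δ (by
    intro n
    have : Δ n ∈ insert ⊤ 𝓕 := hΔ ▸ Set.mem_range_self n
    rcases this with h | h
    · rw [h, Subgroup.coe_top]; exact Set.infinite_univ
    · exact hinf _ h)
  refine ⟨X, t, a, hX, hfree, fun Δ' hΔ' => ?_⟩
  obtain ⟨n, rfl⟩ : Δ' ∈ Set.range Δ := hΔ ▸ Set.mem_insert_of_mem _ hΔ'
  exact hmin n

theorem countable_setOf_fg (Γ : Type u) [Group Γ] [Countable Γ] :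
    {K : Subgroup Γ | K.FG ∧ (K : Set Γ).Infinite}.Countable := by
  refine (Set.countable_range fun S : Finset Γ => Subgroup.closure (S : Set Γ)).mono ?_
  rintro K ⟨⟨S, hS⟩, -⟩
  exact ⟨S, hS⟩

end Flow

theorem mainTheorem12 (Γ : Type u) [Group Γ] [Countable Γ] [Infinite Γ] :
    (∃ (X : Type v) (_ : TopologicalSpace X) (_ : MulAction Γ X),
      IsFlow Γ X ∧ IsFreeAction Γ X ∧
        ∀ Δ : Subgroup Γ, ¬ IsLocallyFiniteSubgroup Δ → IsMinimalFor (Δ : Set Γ) X) ∧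
    ({Δ : Subgroup Γ | (Δ : Set Γ).Infinite ∧ IsLocallyFiniteSubgroup Δ}.Countable →
      ∃ (X : Type v) (_ : TopologicalSpace X) (_ : MulAction Γ X),
        IsFlow Γ X ∧ IsFreeAction Γ X ∧
          ∀ Δ : Subgroup Γ, (Δ : Set Γ).Infinite → IsMinimalFor (Δ : Set Γ) X) := by
  have key : ∀ Δ : Subgroup Γ, ¬ IsLocallyFiniteSubgroup Δ →
      ∃ K ≤ Δ, K.FG ∧ (K : Set Γ).Infinite := by
    intro Δ hΔ
    unfold IsLocallyFiniteSubgroup at hΔ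
    push Not at hΔ
    exact hΔ
  constructor
  · obtain ⟨X, t, a, hX, hfree, hmin⟩ :=
      exists_flow_of_countable.{u, v} (countable_setOf_fg Γ) fun _ h => h.2
    refine ⟨X, t, a, hX, hfree, fun Δ hΔ => ?_⟩
    obtain ⟨K, hK, h⟩ := key Δ hΔ
    exact (hmin K h).mono hK
  · intro hcount
    obtain ⟨X, t, a, hX, hfree, hmin⟩ :=
      exists_flow_of_countable.{u, v} ((countable_setOf_fg Γ).union hcount) (by
        rintro Δ (h | h)
        · exact h.2
        · exact h.1)
    refine ⟨X, t, a, hX, hfree, fun Δ hΔ => ?_⟩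
    by_cases hloc : IsLocallyFiniteSubgroup Δ
    · exact hmin Δ (Or.inr ⟨hΔ, hloc⟩)
    · obtain ⟨K, hK, h⟩ := key Δ hloc
      exact (hmin K (Or.inl h)).mono hK
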